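/- Proposition (Aubin–Lions compactness). Let $X$, $B$, $Y$ be Banach spaces (over the same field $\mathbb R$ or $\mathbb C$), let $1\le p<\infty$ and $T>0$. Assume that $X\hookrightarrow B\hookrightarrow Y$ continuously, that the resulting embedding $X\hookrightarrow Y$ is compact, and that there exist $\theta\in(0,1)$ and $C_\theta>0$ such that $$\|u\|_B\le C_\theta\,\|u\|_X^{1-\theta}\,\|u\|_Y^{\theta}\qquad\text{for all }u\in X.$$ Let $(u_i)_{i\in I}$ be a family (for instance a sequence) of functions $u_i:(0,T]\to X$ with time steps $\tau_i>0$ such that, for each $i$, $T=N_i\tau_i$ for some $N_i\in\mathbb N$ and $u_i$ is constant on each subinterval $((k-1)\tau_i,k\tau_i]$, $1\le k\le N_i$. Assume that (i) $(u_i)$ is bounded in $L^p(0,T;X)$; (ii) there exists $C>0$ such that for all $i\in I$, $\;\|u_i(\cdot+\tau_i)-u_i\|_{L^1(0,T-\tau_i;B)}\le C\tau_i$. Then $\{u_i : i\in I\}$ is relatively compact in $L^q(0,T;B)$ for every real $q$ with $p\le q<p/(1-\theta)$. -/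

import Mathlib

open MeasureTheory Set

open scoped ENNReal

/-- Lebesgue measure on the time interval `(a, b)`, so that `L^p(a, b; E)` is
`MeasureTheory.Lp E p (timeMeasure a b)`. -/
noncomputable def timeMeasure (a b : ℝ) : Measure ℝ :=
  volume.restrict (Ioo a b)

/-- `u` is constant on each subinterval `((k - 1) τ, k τ]`, `1 ≤ k ≤ N`, of `(0, T]`,
where `T = N τ`. -/
def IsPiecewiseConstantInTime {E : Type*} (T τ : ℝ) (u : ℝ → E) : Prop :=
  ∃ N : ℕ, T = N * τ ∧
    ∀ k : ℕ, 1 ≤ k → k ≤ N →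
      ∃ c : E, ∀ t ∈ Ioc (((k : ℝ) - 1) * τ) ((k : ℝ) * τ), u t = c

/-- The family `u` is contained and bounded in `L^p(0, T; E)`. -/
def IsBoundedInLp {ι E : Type*} [NormedAddCommGroup E] (p : ℝ≥0∞) (T : ℝ)
    (u : ι → ℝ → E) : Prop :=
  (∀ i, MemLp (u i) p (timeMeasure 0 T)) ∧
    ∃ M : ℝ, ∀ i, eLpNorm (u i) p (timeMeasure 0 T) ≤ ENNReal.ofReal M

/-- The family `u` is contained in `L^q(0, T; E)`, and the set of its classes has compact closure
in that space. The `Fact` (needed for the norm of the space) and the membership in the space are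
part of what is asserted. -/
def IsRelativelyCompactInLp {ι E : Type*} [NormedAddCommGroup E] (q : ℝ≥0∞) (T : ℝ)
    (u : ι → ℝ → E) : Prop :=
  ∃ _ : Fact (1 ≤ q), ∃ h : ∀ i, MemLp (u i) q (timeMeasure 0 T),
    IsCompact (closure (range fun i => (h i).toLp (u i)))

/-! For a piecewise constant function, the translate by exactly one time step sees every jump, each
on a set of length `τ i`; so the shift bound says that the total variation in `B` is at most `C`,
uniformly in `i`. A function of variation at most `V` is within `h ^ (1 / q) * V` in `L^q` of the
step function obtained by sampling it once in each cell of length `h`, wherever the sample is taken.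

The `L^p` bound in `X` supplies, in each cell, a time at which the `X`-norm is at most some `R`
depending on `h` but not on `i`. By interpolation, `X`-balls are totally bounded in `B`: a
difference of two points of the ball is bounded in `X`, so smallness in `Y` forces smallness in `B`.
Sampling at the good times leaves finitely many cells with values in a totally bounded set, hence a
finite net in `L^q`. -/

theorem totallyBounded_image_closedBall_of_interpolation {𝕜 : Type*} [RCLike 𝕜]
    {X B Y : Type*}
    [NormedAddCommGroup X] [NormedSpace 𝕜 X]
    [NormedAddCommGroup B] [NormedSpace 𝕜 B]
    [NormedAddCommGroup Y] [NormedSpace 𝕜 Y]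
    (eXB : X →L[𝕜] B) (eBY : B →L[𝕜] Y) (hcompact : IsCompactOperator (eBY.comp eXB))
    {θ : ℝ} (hθ0 : 0 < θ) (hθ1 : θ < 1) {Cθ : ℝ} (hCθ : 0 < Cθ)
    (hinterp : ∀ x : X, ‖eXB x‖ ≤ Cθ * ‖x‖ ^ (1 - θ) * ‖eBY (eXB x)‖ ^ θ) (R : ℝ) :
    TotallyBounded (eXB '' Metric.closedBall 0 R) := by
  rw [Metric.totallyBounded_iff]
  intro ε hε
  have hlim : Filter.Tendsto (fun d : ℝ => Cθ * (2 * |R|) ^ (1 - θ) * d ^ θ)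
      (nhdsWithin 0 (Ioi 0)) (nhds (Cθ * (2 * |R|) ^ (1 - θ) * 0 ^ θ)) :=
    (((Real.continuous_rpow_const hθ0.le).tendsto 0).const_mul _).mono_left nhdsWithin_le_nhds
  rw [Real.zero_rpow hθ0.ne', mul_zero] at hlim
  obtain ⟨d, hdε, hd⟩ := ((hlim.eventually_lt_const hε).and self_mem_nhdsWithin).exists
  have hd : 0 < d := hd
  obtain ⟨K, hK, hKs⟩ := IsCompactOperator.image_closedBall_subset_compact
    (f := (eBY.comp eXB : X →ₗ[𝕜] Y)) hcompact R
  -- The net's centres are images of points of the ball itself, so that `x - y` stays bounded in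
  -- `X`.
  obtain ⟨t, ht, htf, hcov⟩ := exists_subset_image_finite_and.1
    (Metric.finite_approx_of_totallyBounded (hK.totallyBounded.subset hKs) d hd)
  refine ⟨eXB '' t, htf.image _, ?_⟩
  rintro _ ⟨x, hx, rfl⟩
  obtain ⟨_, ⟨y, hy, rfl⟩, hxy⟩ := mem_iUnion₂.1 (hcov (mem_image_of_mem _ hx))
  refine mem_iUnion₂.2 ⟨eXB y, mem_image_of_mem _ hy, ?_⟩
  have hx' := mem_closedBall_zero_iff.1 hx
  have hy' := mem_closedBall_zero_iff.1 (ht hy)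
  have hnorm : ‖x - y‖ ≤ 2 * |R| := by
    linarith [norm_sub_le x y, le_abs_self R]
  have hY : ‖eBY (eXB (x - y))‖ ≤ d := by
    rw [Metric.mem_ball, dist_eq_norm] at hxy
    simpa using hxy.le
  rw [Metric.mem_ball, dist_eq_norm, ← map_sub]
  refine (hinterp _).trans_lt (lt_of_le_of_lt ?_ hdε)
  have h1θ : 0 ≤ 1 - θ := by linarith
  gcongr

/-- The step function with value `c j` on the cell `(j h, (j + 1) h]`. -/
noncomputable def stepFunction {E : Type*} (h : ℝ) (c : ℕ → E) (t : ℝ) : E :=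
  c (⌈t / h⌉₊ - 1)

theorem ceil_div_eq_of_mem_cell {h t : ℝ} (hh : 0 < h) {j : ℕ}
    (ht : t ∈ Ioc ((j : ℝ) * h) (((j : ℝ) + 1) * h)) : ⌈t / h⌉₊ = j + 1 := by
  rw [Nat.ceil_eq_iff (by omega)]
  refine ⟨?_, ?_⟩
  · rw [lt_div_iff₀ hh]; simpa using ht.1
  · rw [div_le_iff₀ hh]; simpa using ht.2

theorem stepFunction_of_mem_cell {E : Type*} {h t : ℝ} (hh : 0 < h) (c : ℕ → E) {j : ℕ}
    (ht : t ∈ Ioc ((j : ℝ) * h) (((j : ℝ) + 1) * h)) : stepFunction h c t = c j := by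
  simp [stepFunction, ceil_div_eq_of_mem_cell hh ht]

theorem exists_mem_cell {h t : ℝ} (hh : 0 < h) {m : ℕ} (ht : t ∈ Ioc 0 ((m : ℝ) * h)) :
    ∃ j < m, t ∈ Ioc ((j : ℝ) * h) (((j : ℝ) + 1) * h) := by
  have hpos : 0 < ⌈t / h⌉₊ := Nat.ceil_pos.2 (div_pos ht.1 hh)
  have hle : ⌈t / h⌉₊ ≤ m := Nat.ceil_le.2 ((div_le_iff₀ hh).2 ht.2)
  obtain ⟨j, hj⟩ := Nat.exists_eq_add_of_lt hpos
  have hj : ⌈t / h⌉₊ = j + 1 := by omega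
  have := (Nat.ceil_eq_iff (by omega)).1 hj
  refine ⟨j, by omega, ?_, ?_⟩
  · rw [← lt_div_iff₀ hh]; simpa using this.1
  · rw [← div_le_iff₀ hh]; simpa using this.2

theorem stronglyMeasurable_stepFunction {E : Type*} [TopologicalSpace E] (h : ℝ) (c : ℕ → E) :
    StronglyMeasurable (stepFunction h c) :=
  (StronglyMeasurable.of_discrete (f := fun n : ℕ => c (n - 1))).comp_measurable
    (Nat.measurable_ceil.comp (measurable_id.div_const h))

theorem sum_eVariationOn_cells_le {E : Type*} [PseudoEMetricSpace E] (f : ℝ → E) {h : ℝ}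
    (hh : 0 < h) (n : ℕ) :
    ∑ j ∈ Finset.range n, eVariationOn f (Ioc ((j : ℝ) * h) (((j : ℝ) + 1) * h)) ≤
      eVariationOn f (Ioc 0 ((n : ℝ) * h)) := by
  induction n with
  | zero => simp
  | succ n ih =>
    rw [Finset.sum_range_succ]
    refine (add_le_add_left ih _).trans ((eVariationOn.add_le_union f ?_).trans
      (eVariationOn.mono f ?_))
    · exact fun x hx y hy => hx.2.trans hy.1.le
    · push_cast
      rintro x (hx | hx)
      · exact ⟨hx.1, hx.2.trans (by nlinarith)⟩
      · exact ⟨lt_of_le_of_lt (by positivity) hx.1, hx.2⟩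

theorem ENNReal.sum_rpow_le_rpow_sum {ι : Type*} (s : Finset ι) (a : ι → ℝ≥0∞) {q : ℝ}
    (hq : 1 ≤ q) : ∑ j ∈ s, a j ^ q ≤ (∑ j ∈ s, a j) ^ q := by
  classical
  induction s using Finset.induction_on with
  | empty => simp
  | insert j s hj ih =>
    rw [Finset.sum_insert hj, Finset.sum_insert hj]
    exact (add_le_add_right ih _).trans (ENNReal.add_rpow_le_rpow_add _ _ hq)

/-- On each cell the error is at most the variation `V_j` there, and `∑ V_j ^ q ≤ (∑ V_j) ^ q`. -/
theorem eLpNorm_sub_stepFunction_le {E : Type*} [NormedAddCommGroup E] (f : ℝ → E) {h : ℝ}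
    (hh : 0 < h) (m : ℕ) (s : ℕ → ℝ)
    (hs : ∀ j < m, s j ∈ Ioc ((j : ℝ) * h) (((j : ℝ) + 1) * h)) {q : ℝ} (hq : 1 ≤ q) :
    eLpNorm (fun t => f t - stepFunction h (fun j => f (s j)) t) (ENNReal.ofReal q)
        (timeMeasure 0 ((m : ℝ) * h)) ≤
      ENNReal.ofReal h ^ (1 / q) * eVariationOn f (Ioc 0 ((m : ℝ) * h)) := by
  have hq0 : 0 < q := by linarith
  rw [eLpNorm_eq_lintegral_rpow_enorm_toReal (by simpa using hq0) ENNReal.ofReal_ne_top,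
    ENNReal.toReal_ofReal hq0.le]
  have hcover : Ioo 0 ((m : ℝ) * h) ⊆
      ⋃ j ∈ Finset.range m, Ioc ((j : ℝ) * h) (((j : ℝ) + 1) * h) := by
    intro t ht
    obtain ⟨j, hj, hjt⟩ := exists_mem_cell hh (Ioo_subset_Ioc_self ht)
    exact mem_iUnion₂.2 ⟨j, Finset.mem_range.2 hj, hjt⟩
  have hdisj : ((Finset.range m : Finset ℕ) : Set ℕ).PairwiseDisjoint
      fun j : ℕ => Ioc ((j : ℝ) * h) (((j : ℝ) + 1) * h) := by
    intro i _ j _ hij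
    refine Set.disjoint_left.2 fun t hi hj => hij ?_
    have := (ceil_div_eq_of_mem_cell hh hi).symm.trans (ceil_div_eq_of_mem_cell hh hj)
    omega
  have hint : ∫⁻ t, ‖f t - stepFunction h (fun j => f (s j)) t‖ₑ ^ q
        ∂(timeMeasure 0 ((m : ℝ) * h)) ≤
      eVariationOn f (Ioc 0 ((m : ℝ) * h)) ^ q * ENNReal.ofReal h := by
    refine (lintegral_mono_set hcover).trans ?_
    rw [lintegral_biUnion_finset hdisj fun _ _ => measurableSet_Ioc]
    calc _ ≤ ∑ j ∈ Finset.range m,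
          eVariationOn f (Ioc ((j : ℝ) * h) (((j : ℝ) + 1) * h)) ^ q * ENNReal.ofReal h := by
          refine Finset.sum_le_sum fun j hj => ?_
          refine (setLIntegral_mono' (g := fun _ =>
            eVariationOn f (Ioc ((j : ℝ) * h) (((j : ℝ) + 1) * h)) ^ q)
            measurableSet_Ioc fun t ht => ?_).trans ?_
          · rw [stepFunction_of_mem_cell hh _ ht, ← edist_eq_enorm_sub]
            gcongr
            exact eVariationOn.edist_le f ht (hs j (Finset.mem_range.1 hj))
          · rw [setLIntegral_const, Real.volume_Ioc]
            ring_nf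
            exact le_rfl
      _ ≤ _ := by
          rw [← Finset.sum_mul]
          gcongr
          exact (ENNReal.sum_rpow_le_rpow_sum _ _ hq).trans
            (ENNReal.rpow_le_rpow (sum_eVariationOn_cells_le f hh m) hq0.le)
  refine (ENNReal.rpow_le_rpow hint (by positivity)).trans ?_
  rw [ENNReal.mul_rpow_of_nonneg _ _ (by positivity), ← ENNReal.rpow_mul, mul_one_div_cancel hq0.ne',
    ENNReal.rpow_one, mul_comm]

theorem exists_pos_forall_rpow_mul_le {r : ℝ} (hr : 0 < r) {A ε : ℝ≥0∞} (hA : A ≠ ⊤)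
    (hε : ε ≠ 0) : ∃ δ : ℝ, 0 < δ ∧ ENNReal.ofReal δ ^ r * A < ε := by
  have h1 : Filter.Tendsto (fun δ : ℝ => ENNReal.ofReal δ ^ r * A) (nhds 0)
      (nhds (ENNReal.ofReal 0 ^ r * A)) :=
    ENNReal.Tendsto.mul_const
      (((ENNReal.continuous_rpow_const.comp ENNReal.continuous_ofReal).tendsto 0)) (Or.inr hA)
  rw [ENNReal.ofReal_zero, ENNReal.zero_rpow_of_pos hr, zero_mul] at h1
  obtain ⟨δ, h, hδ⟩ := (((h1.mono_left nhdsWithin_le_nhds).eventually_lt_const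
    (pos_iff_ne_zero.2 hε)).and (self_mem_nhdsWithin (s := Ioi (0 : ℝ)))).exists
  exact ⟨δ, hδ, h⟩

theorem memLp_stepFunction {E : Type*} [NormedAddCommGroup E] {h : ℝ} (hh : 0 < h) (m : ℕ)
    (c : ℕ → E) (q : ℝ≥0∞) : MemLp (stepFunction h c) q (timeMeasure 0 ((m : ℝ) * h)) := by
  have : IsFiniteMeasure (timeMeasure 0 ((m : ℝ) * h)) := by
    unfold timeMeasure; infer_instance
  refine MemLp.of_bound (stronglyMeasurable_stepFunction h c).aestronglyMeasurable
    (∑ j ∈ Finset.range m, ‖c j‖) ?_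
  refine (ae_restrict_iff' measurableSet_Ioo).2 (Filter.Eventually.of_forall fun t ht => ?_)
  obtain ⟨j, hj, hjt⟩ := exists_mem_cell hh (Ioo_subset_Ioc_self ht)
  rw [stepFunction_of_mem_cell hh c hjt]
  exact Finset.single_le_sum (f := fun j => ‖c j‖) (fun _ _ => norm_nonneg _)
    (Finset.mem_range.2 hj)

theorem totallyBounded_range_toLp_of_eVariationOn_le {ι E : Type*} [NormedAddCommGroup E]
    {q : ℝ} (hq : 1 ≤ q) [Fact (1 ≤ ENNReal.ofReal q)] {T : ℝ} (hT : 0 < T) (v : ι → ℝ → E)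
    (hv : ∀ i, MemLp (v i) (ENNReal.ofReal q) (timeMeasure 0 T))
    {V : ℝ≥0∞} (hV : V ≠ ⊤) (hvar : ∀ i, eVariationOn (v i) (Ioc 0 T) ≤ V)
    (hval : ∀ h : ℝ, 0 < h → ∃ K : Set E, TotallyBounded K ∧
      ∀ i a, 0 ≤ a → a + h ≤ T → ∃ t ∈ Ioc a (a + h), v i t ∈ K) :
    TotallyBounded (range fun i => (hv i).toLp (v i)) := by
  have hq0 : 0 < q := by linarith
  rw [EMetric.totallyBounded_iff]
  intro ε hε
  have hε2 : ε / 2 ≠ 0 := (ENNReal.half_pos hε.ne').ne'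
  obtain ⟨η, hη, hηε⟩ := exists_pos_forall_rpow_mul_le (one_div_pos.2 hq0) hV hε2
  obtain ⟨m, hm⟩ := exists_nat_gt (T / η)
  have hm0 : (0 : ℝ) < m := (div_pos hT hη).trans hm
  obtain ⟨h, hh⟩ : ∃ h, h = T / m := ⟨_, rfl⟩
  have hh0 : 0 < h := hh ▸ div_pos hT hm0
  have hhη : h ≤ η := by
    rw [hh, div_le_iff₀ hm0]
    exact ((div_lt_iff₀' hη).1 hm).le
  have hTm : T = m * h := by rw [hh]; field_simp
  subst hTm
  clear hh
  obtain ⟨K, hK, hKv⟩ := hval h hh0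
  have : IsFiniteMeasure (timeMeasure 0 ((m : ℝ) * h)) := by
    unfold timeMeasure; infer_instance
  obtain ⟨δ, hδ, hδε⟩ := exists_pos_forall_rpow_mul_le (r := 1) one_pos
    (A := timeMeasure 0 (m * h) univ ^ (ENNReal.ofReal q).toReal⁻¹)
    (ENNReal.rpow_ne_top_of_nonneg (by positivity) (measure_ne_top _ _)) hε2
  obtain ⟨F, -, hF, hKF⟩ := Metric.finite_approx_of_totallyBounded hK δ hδ
  have : Finite F := hF
  -- The padding by `0` concerns only cells outside the time interval.
  let ext : (Fin m → F) → ℕ → E := fun c j => if hj : j < m then (c ⟨j, hj⟩ : E) else 0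
  refine ⟨range fun c : Fin m → F =>
    (memLp_stepFunction hh0 m (ext c) (ENNReal.ofReal q)).toLp _, finite_range _, ?_⟩
  rintro _ ⟨i, rfl⟩
  have hs : ∀ j : ℕ, ∃ t, j < m → t ∈ Ioc ((j : ℝ) * h) (((j : ℝ) + 1) * h) ∧ v i t ∈ K := by
    intro j
    by_cases hj : j < m
    · have hj' : (j : ℝ) + 1 ≤ m := by exact_mod_cast hj
      obtain ⟨t, ht, htK⟩ := hKv i (j * h) (by positivity) (by nlinarith)
      refine ⟨t, fun _ => ⟨?_, htK⟩⟩
      rwa [add_one_mul]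
    · exact ⟨0, fun h => absurd h hj⟩
  choose s hs using hs
  have hc : ∀ j : Fin m, ∃ c : F, dist (v i (s j)) c < δ := by
    intro j
    obtain ⟨c, hcF, hc⟩ := mem_iUnion₂.1 (hKF (hs j j.2).2)
    exact ⟨⟨c, hcF⟩, hc⟩
  choose c hc using hc
  refine mem_iUnion₂.2 ⟨_, mem_range_self c, ?_⟩
  rw [Metric.mem_eball, Lp.edist_toLp_toLp]
  have hsplit : v i - stepFunction h (ext c) =
      (fun t => v i t - stepFunction h (fun j => v i (s j)) t) +
      (fun t => stepFunction h (fun j => v i (s j)) t - stepFunction h (ext c) t) := by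
    ext t; simp
  rw [hsplit, ← ENNReal.add_halves ε]
  refine (eLpNorm_add_le ?_ ?_ Fact.out).trans_lt (ENNReal.add_lt_add ?_ ?_)
  · exact (hv i).1.sub (stronglyMeasurable_stepFunction _ _).aestronglyMeasurable
  · exact ((stronglyMeasurable_stepFunction _ _).sub
      (stronglyMeasurable_stepFunction _ _)).aestronglyMeasurable
  · refine (eLpNorm_sub_stepFunction_le (v i) hh0 m s (fun j hj => (hs j hj).1) hq).trans_lt ?_
    refine lt_of_le_of_lt ?_ hηε
    gcongr
    exact hvar i
  · refine (eLpNorm_le_of_ae_bound (C := δ) ?_).trans_lt ?_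
    · refine (ae_restrict_iff' measurableSet_Ioo).2 (Filter.Eventually.of_forall fun t ht => ?_)
      obtain ⟨j, hj, hjt⟩ := exists_mem_cell hh0 (Ioo_subset_Ioc_self ht)
      rw [stepFunction_of_mem_cell hh0 _ hjt, stepFunction_of_mem_cell hh0 _ hjt, ← dist_eq_norm]
      simpa [ext, hj] using (hc ⟨j, hj⟩).le
    · rwa [mul_comm, ← ENNReal.rpow_one (ENNReal.ofReal δ)]

theorem eVariationOn_Icc_nat_le_sum {E : Type*} [PseudoEMetricSpace E] (c : ℕ → E) (n : ℕ) :
    eVariationOn c (Icc 0 n) ≤ ∑ k ∈ Finset.range n, edist (c (k + 1)) (c k) := by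
  induction n with
  | zero => simp [eVariationOn.subsingleton]
  | succ n ih =>
    have hadd := eVariationOn.Icc_add_Icc c (s := univ) (Nat.zero_le n) n.le_succ (mem_univ _)
    simp only [univ_inter] at hadd
    rw [Finset.sum_range_succ, ← hadd]
    have hpair : Icc n (n + 1) = {n + 1, n} := by
      ext k
      simp only [mem_Icc, mem_insert_iff, mem_singleton_iff]
      omega
    rw [hpair, eVariationOn.pair]
    exact add_le_add_left ih _

/-- The total variation of a piecewise constant function is controlled by its difference with its
translate by one time step. -/
theorem eVariationOn_mul_le_of_isPiecewiseConstantInTime {E : Type*} [NormedAddCommGroup E]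
    {T τ : ℝ} (hτ : 0 < τ) {f : ℝ → E} (hf : IsPiecewiseConstantInTime T τ f) :
    ENNReal.ofReal τ * eVariationOn f (Ioc 0 T) ≤
      eLpNorm (fun t => f (t + τ) - f t) 1 (timeMeasure 0 (T - τ)) := by
  obtain ⟨N, rfl, hN⟩ := hf
  obtain ⟨d, hd⟩ : ∃ d : ℕ → E, ∀ j < N, ∀ t ∈ Ioc ((j : ℝ) * τ) (((j : ℝ) + 1) * τ),
      f t = d j := by
    refine ⟨fun j => f (((j : ℝ) + 1) * τ), fun j hj t ht => ?_⟩
    obtain ⟨c, hc⟩ := hN (j + 1) (by omega) hj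
    simp only [Nat.cast_add, Nat.cast_one, add_sub_cancel_right] at hc
    exact (hc t ht).trans (hc _ (right_mem_Ioc.2 (ht.1.trans_le ht.2))).symm
  have hvar : eVariationOn f (Ioc 0 ((N : ℝ) * τ)) ≤
      ∑ k ∈ Finset.range (N - 1), edist (d (k + 1)) (d k) := by
    -- `f` factors through the monotone cell index, so its variation is at most that of the sequence
    -- `d`.
    have heq : EqOn f (d ∘ fun t => ⌈t / τ⌉₊ - 1) (Ioc 0 ((N : ℝ) * τ)) := by
      intro t ht
      obtain ⟨j, hj, hjt⟩ := exists_mem_cell hτ ht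
      simp [hd j hj t hjt, ceil_div_eq_of_mem_cell hτ hjt]
    rw [eVariationOn.congr heq]
    refine (eVariationOn.comp_le_of_monotoneOn d (s := Icc 0 (N - 1)) _ ?_ ?_).trans
      (eVariationOn_Icc_nat_le_sum d (N - 1))
    · intro x _ y _ hxy
      exact Nat.sub_le_sub_right (Nat.ceil_mono (by gcongr)) 1
    · intro t ht
      have : ⌈t / τ⌉₊ ≤ N := Nat.ceil_le.2 ((div_le_iff₀ hτ).2 ht.2)
      exact ⟨Nat.zero_le _, Nat.sub_le_sub_right this 1⟩
  have hdisj : ((Finset.range (N - 1) : Finset ℕ) : Set ℕ).PairwiseDisjoint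
      fun j : ℕ => Ioo ((j : ℝ) * τ) (((j : ℝ) + 1) * τ) := by
    intro i _ j _ hij
    refine Set.disjoint_left.2 fun t hi hj => hij ?_
    have := (ceil_div_eq_of_mem_cell hτ (Ioo_subset_Ioc_self hi)).symm.trans
      (ceil_div_eq_of_mem_cell hτ (Ioo_subset_Ioc_self hj))
    omega
  -- The `N - 1` jumps match the `N - 1` cells that fill `(0, T - τ)`.
  have hsub : (⋃ j ∈ Finset.range (N - 1), Ioo ((j : ℝ) * τ) (((j : ℝ) + 1) * τ)) ⊆
      Ioo 0 ((N : ℝ) * τ - τ) := by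
    refine iUnion₂_subset fun j hj t ht => ⟨lt_of_le_of_lt (by positivity) ht.1, ?_⟩
    have hj : (j : ℝ) + 1 + 1 ≤ N := by
      have := Finset.mem_range.1 hj
      exact_mod_cast (by omega : j + 1 + 1 ≤ N)
    nlinarith [ht.2]
  rw [eLpNorm_one_eq_lintegral_enorm]
  refine le_trans ?_ (lintegral_mono_set hsub)
  rw [lintegral_biUnion_finset hdisj fun _ _ => measurableSet_Ioo]
  refine (mul_le_mul_right hvar _).trans ?_
  rw [Finset.mul_sum]
  refine Finset.sum_le_sum fun j hj => ?_
  have hj : j + 1 < N := by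
    have := Finset.mem_range.1 hj
    omega
  rw [setLIntegral_congr_fun (g := fun _ => edist (d (j + 1)) (d j)) measurableSet_Ioo,
    setLIntegral_const, Real.volume_Ioo, mul_comm]
  · ring_nf
    exact le_rfl
  · intro t ht
    simp only
    rw [hd j (by omega) t (Ioo_subset_Ioc_self ht), hd (j + 1) hj (t + τ) ?_, edist_eq_enorm_sub]
    push_cast
    constructor <;> nlinarith [ht.1, ht.2]

/-- If the norm exceeded `R` on a whole interval of length `h`, the `L^p` norm would be at least `R
* h ^ (1 / p)`; `R` is chosen to make this `|M| + 1`. -/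
theorem exists_mem_Ioc_norm_le {E : Type*} [NormedAddCommGroup E] {p : ℝ} (hp : 1 ≤ p)
    {T M h : ℝ} (hh : 0 < h) :
    ∃ R : ℝ, ∀ f : ℝ → E, eLpNorm f (ENNReal.ofReal p) (timeMeasure 0 T) ≤ ENNReal.ofReal M →
      ∀ a, 0 ≤ a → a + h ≤ T → ∃ t ∈ Ioc a (a + h), ‖f t‖ ≤ R := by
  have hp0 : 0 < p := by linarith
  have hhp : 0 < h ^ (1 / p) := Real.rpow_pos_of_pos hh _
  refine ⟨(|M| + 1) / h ^ (1 / p), fun f hf a ha haT => ?_⟩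
  by_contra! hlt
  have hR : 0 ≤ (|M| + 1) / h ^ (1 / p) := by positivity
  have hle : eLpNorm (fun _ : ℝ => (|M| + 1) / h ^ (1 / p)) (ENNReal.ofReal p)
      (timeMeasure a (a + h)) ≤ ENNReal.ofReal M := by
    refine (eLpNorm_mono_ae (g := f) ?_).trans
      ((eLpNorm_mono_measure f (Measure.restrict_mono_set _ (Ioo_subset_Ioo ha haT))).trans hf)
    refine (ae_restrict_iff' measurableSet_Ioo).2 (Filter.Eventually.of_forall fun t ht => ?_)
    rw [Real.norm_of_nonneg hR]
    exact (hlt t (Ioo_subset_Ioc_self ht)).le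
  have huniv : timeMeasure a (a + h) univ = ENNReal.ofReal h := by
    simp [timeMeasure]
  rw [eLpNorm_const _ (by simpa using hp0), huniv, ENNReal.toReal_ofReal hp0.le,
    Real.enorm_of_nonneg hR, ENNReal.ofReal_rpow_of_pos hh, ← ENNReal.ofReal_mul hR,
    div_mul_cancel₀ _ hhp.ne', ENNReal.ofReal_le_ofReal_iff'] at hle
  · rcases hle with hle | hle <;> linarith [le_abs_self M, abs_nonneg M]
  · intro h0
    simp [h0] at huniv
    linarith

theorem mainTheorem6 {𝕜 : Type*} [RCLike 𝕜]
    {X B Y : Type*}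
    [NormedAddCommGroup X] [NormedSpace 𝕜 X] [CompleteSpace X]
    [NormedAddCommGroup B] [NormedSpace 𝕜 B] [CompleteSpace B]
    [NormedAddCommGroup Y] [NormedSpace 𝕜 Y] [CompleteSpace Y]
    -- the continuous embeddings of `X` into `B` and of `B` into `Y`
    (eXB : X →L[𝕜] B) (heXB : Function.Injective eXB)
    (eBY : B →L[𝕜] Y) (heBY : Function.Injective eBY)
    -- the embedding of `X` into `Y` is compact
    (hcompact : IsCompactOperator (eBY.comp eXB))
    (θ : ℝ) (hθ0 : 0 < θ) (hθ1 : θ < 1)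
    (Cθ : ℝ) (hCθ : 0 < Cθ)
    (hinterp : ∀ x : X, ‖eXB x‖ ≤ Cθ * ‖x‖ ^ (1 - θ) * ‖eBY (eXB x)‖ ^ θ)
    (p : ℝ) (hp : 1 ≤ p) (T : ℝ) (hT : 0 < T)
    -- the functions `u i`, with time steps `τ i`
    {ι : Type*} (τ : ι → ℝ) (u : ι → ℝ → X)
    (hpw : ∀ i, IsPiecewiseConstantInTime T (τ i) (u i))
    (hbdd : IsBoundedInLp (ENNReal.ofReal p) T u)
    (hshift : ∃ C : ℝ, 0 < C ∧ ∀ i,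
      eLpNorm (fun t => eXB (u i (t + τ i)) - eXB (u i t)) 1 (timeMeasure 0 (T - τ i))
        ≤ ENNReal.ofReal (C * τ i)) :
    ∀ q : ℝ, p ≤ q → q < p / (1 - θ) →
      IsRelativelyCompactInLp (ENNReal.ofReal q) T (fun i t => eXB (u i t)) := by
  intro q hpq _
  have hq : 1 ≤ q := hp.trans hpq
  have hfact : Fact (1 ≤ ENNReal.ofReal q) := ⟨by simpa using hq⟩
  obtain ⟨C, hC, hshift⟩ := hshift
  obtain ⟨hmem, M, hM⟩ := hbdd
  have hτ : ∀ i, 0 < τ i := by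
    intro i
    obtain ⟨N, hN, -⟩ := hpw i
    exact pos_of_mul_pos_right (hN ▸ hT) N.cast_nonneg
  have hvar : ∀ i, eVariationOn (fun t => eXB (u i t)) (Ioc 0 T) ≤ ENNReal.ofReal C := by
    intro i
    have hpwB : IsPiecewiseConstantInTime T (τ i) fun t => eXB (u i t) := by
      obtain ⟨N, hN, hc⟩ := hpw i
      refine ⟨N, hN, fun k hk hkN => ?_⟩
      obtain ⟨c, hc⟩ := hc k hk hkN
      exact ⟨eXB c, fun t ht => congrArg eXB (hc t ht)⟩
    have hle := (eVariationOn_mul_le_of_isPiecewiseConstantInTime (hτ i) hpwB).trans (hshift i)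
    rw [mul_comm C, ENNReal.ofReal_mul (hτ i).le] at hle
    exact (ENNReal.mul_le_mul_iff_right (by simpa using hτ i) ENNReal.ofReal_ne_top).1 hle
  have hv : ∀ i, MemLp (fun t => eXB (u i t)) (ENNReal.ofReal q) (timeMeasure 0 T) := by
    intro i
    have : IsFiniteMeasure (timeMeasure 0 T) := by
      unfold timeMeasure; infer_instance
    refine MemLp.of_bound (eXB.continuous.comp_aestronglyMeasurable (hmem i).1)
      (‖eXB (u i T)‖ + C) ?_
    refine (ae_restrict_iff' measurableSet_Ioo).2 (Filter.Eventually.of_forall fun t ht => ?_)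
    -- Bounded variation gives boundedness: every value lies within `C` of the value at `T`.
    have hdist := (eVariationOn.edist_le (fun t => eXB (u i t)) (Ioo_subset_Ioc_self ht)
      (right_mem_Ioc.2 hT)).trans (hvar i)
    rw [edist_le_ofReal hC.le, dist_eq_norm] at hdist
    exact (norm_le_norm_add_norm_sub' _ (eXB (u i T))).trans (by gcongr)
  refine ⟨hfact, hv, TotallyBounded.isCompact_of_isClosed ?_ isClosed_closure⟩
  refine (totallyBounded_range_toLp_of_eVariationOn_le hq hT _ hv ENNReal.ofReal_ne_top hvar
    fun h hh => ?_).closure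
  obtain ⟨R, hR⟩ := exists_mem_Ioc_norm_le (E := X) hp (T := T) (M := M) hh
  refine ⟨_, totallyBounded_image_closedBall_of_interpolation eXB eBY hcompact hθ0 hθ1 hCθ
    hinterp R, fun i a ha haT => ?_⟩
  obtain ⟨t, ht, htR⟩ := hR (u i) (hM i) a ha haT
  exact ⟨t, ht, mem_image_of_mem _ (by simpa using htR)⟩
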